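/- All rings are associative with identity, not necessarily commutative, and all modules are unitary. A left $R$-module $M$ is Gorenstein flat if there is an exact sequence $\cdots\to F_1\to F_0\to F^0\to F^1\to\cdots$ of flat left $R$-modules with $M\cong\operatorname{Im}(F_0\to F^0)$ that remains exact after applying $I\otimes_R-$ for every injective right $R$-module $I$. A ring $R$ is left GF-closed if, for every short exact sequence $0\to A\to B\to C\to 0$ of left $R$-modules with $A$ and $C$ Gorenstein flat, $B$ is Gorenstein flat. A ring is right coherent if each of its finitely generated right ideals is a finitely presented right module. The weak dimension of $R$ is the supremum in $\mathbb{N}\cup\{\infty\}$ of the flat dimensions of all left $R$-modules, where the flat dimension of $M$ is the least $n$ for which there is an exact sequence $0\to F_n\to\cdots\to F_0\to M\to 0$ with all $F_i$ flat ($\infty$ if there is no such $n$). **Proposition.** Let $R$ be a ring. 1. If $R$ is right coherent, then $R$ is left GF-closed. 2. If $R$ has finite weak dimension, then $R$ is left GF-closed. 3. If $R$ has finite weak dimension, then a left $R$-module is Gorenstein flat if and only if it is flat. -/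

import Mathlib

open scoped TensorProduct

universe u

namespace GFClosed

section Tensor

/-- The subgroup of `I ⊗ M` (tensor product over `ℤ`) generated by all elements
`(x r) ⊗ m - x ⊗ (r m)`. A right `R`-module is a module over `Rᵐᵒᵖ`, with
`x r = MulOpposite.op r • x`. -/
def balancedRel (R : Type*) [Ring R] (I M : Type*) [AddCommGroup I] [Module Rᵐᵒᵖ I]
    [AddCommGroup M] [Module R M] : AddSubgroup (I ⊗[ℤ] M) :=
  AddSubgroup.closure
    {t | ∃ (x : I) (r : R) (m : M), t = (MulOpposite.op r • x) ⊗ₜ[ℤ] m - x ⊗ₜ[ℤ] (r • m)}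

/-- The tensor product `I ⊗_R M` of a right `R`-module `I` and a left `R`-module `M` over a ring
`R` that need not be commutative; it is an abelian group. -/
abbrev BalancedTensor (R : Type*) [Ring R] (I M : Type*) [AddCommGroup I] [Module Rᵐᵒᵖ I]
    [AddCommGroup M] [Module R M] : Type _ :=
  (I ⊗[ℤ] M) ⧸ balancedRel R I M

/-- The homomorphism `f ⊗_R g : I ⊗_R M → J ⊗_R N`. -/
noncomputable def BalancedTensor.map {R : Type*} [Ring R] {I J M N : Type*}
    [AddCommGroup I] [Module Rᵐᵒᵖ I] [AddCommGroup J] [Module Rᵐᵒᵖ J]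
    [AddCommGroup M] [Module R M] [AddCommGroup N] [Module R N]
    (f : I →ₗ[Rᵐᵒᵖ] J) (g : M →ₗ[R] N) : BalancedTensor R I M →+ BalancedTensor R J N :=
  QuotientAddGroup.map (balancedRel R I M) (balancedRel R J N)
    (TensorProduct.map f.toAddMonoidHom.toIntLinearMap
      g.toAddMonoidHom.toIntLinearMap).toAddMonoidHom (by
      refine (AddSubgroup.closure_le _).2 ?_
      rintro t ⟨x, r, m, rfl⟩
      refine AddSubgroup.subset_closure ⟨f x, r, g m, ?_⟩
      simp)

end Tensor

section Flat

/-- A left `R`-module `M` is flat if `- ⊗_R M` preserves injectivity of homomorphisms of right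
`R`-modules. -/
def IsFlat (R : Type u) [Ring R] (M : Type u) [AddCommGroup M] [Module R M] : Prop :=
  ∀ (I J : Type u) [AddCommGroup I] [AddCommGroup J] [Module Rᵐᵒᵖ I] [Module Rᵐᵒᵖ J]
    (f : I →ₗ[Rᵐᵒᵖ] J), Function.Injective f →
      Function.Injective (BalancedTensor.map f (LinearMap.id : M →ₗ[R] M))

/-- There is an exact sequence `0 → F n → ⋯ → F 1 → F 0 → M → 0` of left `R`-modules with every
`F i` flat (written as an infinite sequence that vanishes in degrees above `n`). -/
def HasFlatResolution (R : Type u) [Ring R] (M : Type u) [AddCommGroup M] [Module R M]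
    (n : ℕ) : Prop :=
  ∃ (F : ℕ → ModuleCat.{u} R) (d : ∀ i, F (i + 1) →ₗ[R] F i) (ε : F 0 →ₗ[R] M),
    (∀ i, IsFlat R (F i)) ∧
    Function.Surjective ε ∧
    Function.Exact (d 0) ε ∧
    (∀ i, Function.Exact (d (i + 1)) (d i)) ∧
    ∀ i, n < i → Subsingleton (F i)

/-- The flat dimension of a left `R`-module, `⊤` if there is no finite flat resolution. -/
noncomputable def flatDim (R : Type u) [Ring R] (M : Type u) [AddCommGroup M] [Module R M] : ℕ∞ :=
  sInf {k : ℕ∞ | ∃ n : ℕ, k = n ∧ HasFlatResolution R M n}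

/-- The weak dimension of `R`: the supremum of the flat dimensions of all left `R`-modules. -/
noncomputable def weakDim (R : Type u) [Ring R] : ℕ∞ :=
  ⨆ M : ModuleCat.{u} R, flatDim R M

end Flat

/-- `R` is right coherent if every finitely generated right ideal of `R` is a finitely presented
right `R`-module. -/
def IsRightCoherent (R : Type u) [Ring R] : Prop :=
  ∀ I : Submodule Rᵐᵒᵖ R, I.FG → Module.FinitePresentation Rᵐᵒᵖ I

/-- A left `R`-module `M` is Gorenstein flat if there is an exact sequence
`⋯ → F (-1) → F 0 → F 1 → F 2 → ⋯` of flat left `R`-modules that remains exact under `I ⊗_R -` for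
every injective right `R`-module `I`, such that `M` is isomorphic to the image of `F 0 → F 1`. -/
def IsGorensteinFlat (R : Type u) [Ring R] (M : Type u) [AddCommGroup M] [Module R M] : Prop :=
  ∃ (F : ℤ → ModuleCat.{u} R) (d : ∀ i, F i →ₗ[R] F (i + 1)),
    (∀ i, IsFlat R (F i)) ∧
    (∀ i, Function.Exact (d i) (d (i + 1))) ∧
    (∀ (I : Type u) [AddCommGroup I] [Module Rᵐᵒᵖ I], Module.Injective Rᵐᵒᵖ I →
      ∀ i, Function.Exact
        (BalancedTensor.map (LinearMap.id : I →ₗ[Rᵐᵒᵖ] I) (d i))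
        (BalancedTensor.map (LinearMap.id : I →ₗ[Rᵐᵒᵖ] I) (d (i + 1)))) ∧
    Nonempty (M ≃ₗ[R] LinearMap.range (d 0))

/-- `R` is left GF-closed if the class of Gorenstein flat left `R`-modules is closed under
extensions. -/
def IsLeftGFClosed (R : Type u) [Ring R] : Prop :=
  ∀ (A B C : Type u) [AddCommGroup A] [AddCommGroup B] [AddCommGroup C]
    [Module R A] [Module R B] [Module R C] (f : A →ₗ[R] B) (g : B →ₗ[R] C),
    Function.Injective f → Function.Exact f g → Function.Surjective g →
    IsGorensteinFlat R A → IsGorensteinFlat R C → IsGorensteinFlat R B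

end GFClosed

/-! Write X⁺ = Hom(X, ℚ/ℤ). Characters of I ⊗ M are the homomorphisms M → I⁺, equivalently I → M⁺,
so every condition on tensor products becomes one on Hom and Ext. A module M is flat iff M⁺ is
injective, iff Ext¹(M, J⁺) = 0 for all right modules J. It is Gorenstein flat iff M ≅ Z₁ for some
chain of short exact sequences 0 → Zᵢ → Fᵢ → Zᵢ₊₁ → 0 (i ∈ ℤ) with Fᵢ flat and Ext¹(Zᵢ, I⁺) = 0 for
all injective I (`IsGorensteinFlat.exists_chain`, `IsGorensteinFlat.of_chain`).

Finite weak dimension: Ext^m(-, J⁺) vanishes for all large m, and dimension shifting along the chain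
brings this down to Ext¹(Zᵢ, J⁺) = 0. So Gorenstein flat modules are flat, and flat modules are
closed under extensions.

Right coherent: duals of injectives are flat (`IsRightCoherent.isFlat_dual`), so for F flat both F⁺⁺
and F⁺⁺/F are flat. A Gorenstein flat M ⊆ F with cokernel C also embeds in F⁺⁺, whose advantage is
that Ext¹(D, F⁺⁺) = 0 for every D with Ext¹(D, I⁺) = 0 for injective I; this permits a horseshoe
construction for extensions. The new cokernel is only an extension of F⁺⁺/F by C, so the argument
runs in the class of iterated extensions of Gorenstein flat modules
(`IsGFFiltered.exists_flat_embedding`). Embeddings extend the chain to the right, projective covers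
to the left. -/

namespace GFClosed

/-! ### Characters with values in ℚ/ℤ. -/

section Characters

theorem exists_character_extension {A B : Type*} [AddCommGroup A] [AddCommGroup B]
    (f : A →+ B) (hf : Function.Injective f) (c : A →+ AddCircle (1 : ℚ)) :
    ∃ c' : B →+ AddCircle (1 : ℚ), ∀ a, c' (f a) = c a := by
  obtain ⟨c', h⟩ := CharacterModule.dual_surjective_of_injective f.toIntLinearMap hf c
  exact ⟨c', fun a => DFunLike.congr_fun h a⟩

theorem exists_character_factor {B C : Type*} [AddCommGroup B] [AddCommGroup C]
    (g : B →+ C) (c : B →+ AddCircle (1 : ℚ)) (h : ∀ b, g b = 0 → c b = 0) :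
    ∃ c' : C →+ AddCircle (1 : ℚ), ∀ b, c' (g b) = c b := by
  obtain ⟨c', hc'⟩ := exists_character_extension (QuotientAddGroup.kerLift g)
    (QuotientAddGroup.kerLift_injective g)
    (QuotientAddGroup.lift g.ker c fun b hb => h b hb)
  exact ⟨c', fun b => hc' (QuotientAddGroup.mk b)⟩

theorem eq_zero_of_character {A : Type*} [AddCommGroup A] {a : A}
    (h : ∀ c : A →+ AddCircle (1 : ℚ), c a = 0) : a = 0 :=
  CharacterModule.eq_zero_of_character_apply (A := A) fun c => h c

theorem mem_of_character {A : Type*} [AddCommGroup A] (S : AddSubgroup A) {a : A}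
    (h : ∀ c : A →+ AddCircle (1 : ℚ), (∀ s ∈ S, c s = 0) → c a = 0) : a ∈ S := by
  rw [← QuotientAddGroup.eq_zero_iff]
  refine eq_zero_of_character fun c => ?_
  refine h (c.comp (QuotientAddGroup.mk' S)) fun s hs => ?_
  have : (QuotientAddGroup.mk' S) s = 0 := (QuotientAddGroup.eq_zero_iff s).2 hs
  exact (congrArg c this).trans (map_zero c)

theorem injective_iff_character {A B : Type*} [AddCommGroup A] [AddCommGroup B] (f : A →+ B) :
    Function.Injective f ↔
      ∀ c : A →+ AddCircle (1 : ℚ), ∃ c' : B →+ AddCircle (1 : ℚ), ∀ a, c' (f a) = c a := by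
  refine ⟨exists_character_extension f, fun h => (injective_iff_map_eq_zero f).2 fun a ha => ?_⟩
  refine eq_zero_of_character fun c => ?_
  obtain ⟨c', hc'⟩ := h c
  rw [← hc', ha, map_zero]

theorem exact_iff_character {A B C : Type*} [AddCommGroup A] [AddCommGroup B] [AddCommGroup C]
    (f : A →+ B) (g : B →+ C) (hgf : ∀ a, g (f a) = 0) :
    Function.Exact f g ↔ ∀ c : B →+ AddCircle (1 : ℚ), (∀ a, c (f a) = 0) →
      ∃ c' : C →+ AddCircle (1 : ℚ), ∀ b, c' (g b) = c b := by
  refine ⟨fun h c hc => exists_character_factor g c fun b hb => ?_, fun h b =>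
    ⟨fun hb => ?_, ?_⟩⟩
  · obtain ⟨a, rfl⟩ := (h b).1 hb
    exact hc a
  · refine mem_of_character f.range fun c hc => ?_
    obtain ⟨c', hc'⟩ := h c fun a => hc _ ⟨a, rfl⟩
    rw [← hc', hb, map_zero]
  · rintro ⟨a, rfl⟩
    exact hgf a

end Characters

/-! ### Character modules and the adjunction Hom(M, J⁺) ≅ Hom(J, M⁺). -/

section Duals

/-- The character module of a right module, as a left module. -/
def LDual (_R : Type*) (I : Type*) [AddCommGroup I] : Type _ := I →+ AddCircle (1 : ℚ)

/-- The character module of a left module, as a right module. -/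
def RDual (_R : Type*) (M : Type*) [AddCommGroup M] : Type _ := M →+ AddCircle (1 : ℚ)

variable (R : Type*)

noncomputable instance (I : Type*) [AddCommGroup I] : AddCommGroup (LDual R I) :=
  inferInstanceAs (AddCommGroup (I →+ AddCircle (1 : ℚ)))

noncomputable instance (I : Type*) [AddCommGroup I] : AddCommGroup (RDual R I) :=
  inferInstanceAs (AddCommGroup (I →+ AddCircle (1 : ℚ)))

instance (I : Type*) [AddCommGroup I] : FunLike (LDual R I) I (AddCircle (1 : ℚ)) :=
  inferInstanceAs (FunLike (I →+ AddCircle (1 : ℚ)) I (AddCircle (1 : ℚ)))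

instance (I : Type*) [AddCommGroup I] : FunLike (RDual R I) I (AddCircle (1 : ℚ)) :=
  inferInstanceAs (FunLike (I →+ AddCircle (1 : ℚ)) I (AddCircle (1 : ℚ)))

instance (I : Type*) [AddCommGroup I] : AddMonoidHomClass (LDual R I) I (AddCircle (1 : ℚ)) :=
  inferInstanceAs (AddMonoidHomClass (I →+ AddCircle (1 : ℚ)) I (AddCircle (1 : ℚ)))

instance (I : Type*) [AddCommGroup I] : AddMonoidHomClass (RDual R I) I (AddCircle (1 : ℚ)) :=
  inferInstanceAs (AddMonoidHomClass (I →+ AddCircle (1 : ℚ)) I (AddCircle (1 : ℚ)))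

variable {R}

@[simp] theorem LDual.add_apply {I : Type*} [AddCommGroup I] (a b : LDual R I) (x : I) :
    (a + b) x = a x + b x := rfl

@[simp] theorem RDual.add_apply {I : Type*} [AddCommGroup I] (a b : RDual R I) (x : I) :
    (a + b) x = a x + b x := rfl

@[simp] theorem LDual.zero_apply {I : Type*} [AddCommGroup I] (x : I) :
    (0 : LDual R I) x = 0 := rfl

@[simp] theorem RDual.zero_apply {I : Type*} [AddCommGroup I] (x : I) :
    (0 : RDual R I) x = 0 := rfl

theorem LDual.sum_apply {I ι : Type*} [AddCommGroup I] (s : Finset ι) (f : ι → LDual R I) (x : I) :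
    (∑ i ∈ s, f i) x = ∑ i ∈ s, f i x := AddMonoidHom.finsetSum_apply (N := AddCircle (1 : ℚ)) f s x

theorem RDual.sum_apply {I ι : Type*} [AddCommGroup I] (s : Finset ι) (f : ι → RDual R I) (x : I) :
    (∑ i ∈ s, f i) x = ∑ i ∈ s, f i x := AddMonoidHom.finsetSum_apply (N := AddCircle (1 : ℚ)) f s x

@[ext] theorem LDual.ext {I : Type*} [AddCommGroup I] {a b : LDual R I} (h : ∀ x, a x = b x) :
    a = b := DFunLike.ext _ _ h

@[ext] theorem RDual.ext {I : Type*} [AddCommGroup I] {a b : RDual R I} (h : ∀ x, a x = b x) :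
    a = b := DFunLike.ext _ _ h

variable [Ring R]

noncomputable instance (I : Type*) [AddCommGroup I] [Module Rᵐᵒᵖ I] : Module R (LDual R I) where
  smul r φ := AddMonoidHom.comp φ (DistribSMul.toAddMonoidHom I (MulOpposite.op r))
  one_smul φ := LDual.ext fun x => congrArg φ (by simp)
  mul_smul r s φ := LDual.ext fun x => congrArg φ (by simp [mul_smul])
  smul_zero r := rfl
  smul_add r φ ψ := rfl
  add_smul r s φ := LDual.ext fun x =>
    (congrArg φ (show MulOpposite.op (r + s) • x = _ by
      rw [MulOpposite.op_add, add_smul]; rfl)).trans (map_add φ _ _)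
  zero_smul φ := LDual.ext fun x =>
    (congrArg φ (show MulOpposite.op (0 : R) • x = 0 by simp)).trans (map_zero φ)

noncomputable instance (M : Type*) [AddCommGroup M] [Module R M] : Module Rᵐᵒᵖ (RDual R M) where
  smul r φ := AddMonoidHom.comp φ (DistribSMul.toAddMonoidHom M r.unop)
  one_smul φ := RDual.ext fun x => congrArg φ (by simp)
  mul_smul r s φ := RDual.ext fun x => congrArg φ (by simp [mul_smul])
  smul_zero r := rfl
  smul_add r φ ψ := rfl
  add_smul r s φ := RDual.ext fun x =>
    (congrArg φ (show (r + s).unop • x = _ by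
      rw [MulOpposite.unop_add, add_smul]; rfl)).trans (map_add φ _ _)
  zero_smul φ := RDual.ext fun x =>
    (congrArg φ (show (0 : Rᵐᵒᵖ).unop • x = 0 by simp)).trans (map_zero φ)

variable {I J : Type*} [AddCommGroup I] [Module Rᵐᵒᵖ I] [AddCommGroup J] [Module Rᵐᵒᵖ J]
  {M N : Type*} [AddCommGroup M] [Module R M] [AddCommGroup N] [Module R N]

@[simp] theorem LDual.smul_apply (r : R) (φ : LDual R I) (x : I) :
    (r • φ) x = φ (MulOpposite.op r • x) := rfl

@[simp] theorem RDual.smul_apply (r : Rᵐᵒᵖ) (φ : RDual R M) (x : M) :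
    (r • φ) x = φ (r.unop • x) := rfl

/-- Precomposition with a homomorphism of right modules. -/
noncomputable def LDual.map (f : I →ₗ[Rᵐᵒᵖ] J) : LDual R J →ₗ[R] LDual R I where
  toFun φ := AddMonoidHom.comp φ f.toAddMonoidHom
  map_add' _ _ := rfl
  map_smul' _ φ := LDual.ext fun x => congrArg φ (f.map_smul _ x).symm

/-- Precomposition with a homomorphism of left modules. -/
noncomputable def RDual.map (f : M →ₗ[R] N) : RDual R N →ₗ[Rᵐᵒᵖ] RDual R M where
  toFun φ := AddMonoidHom.comp φ f.toAddMonoidHom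
  map_add' _ _ := rfl
  map_smul' _ φ := RDual.ext fun x => congrArg φ (f.map_smul _ x).symm

@[simp] theorem LDual.map_apply (f : I →ₗ[Rᵐᵒᵖ] J) (φ : LDual R J) (x : I) :
    LDual.map f φ x = φ (f x) := rfl

@[simp] theorem RDual.map_apply (f : M →ₗ[R] N) (φ : RDual R N) (x : M) :
    RDual.map f φ x = φ (f x) := rfl

theorem LDual.map_surjective (f : I →ₗ[Rᵐᵒᵖ] J) (hf : Function.Injective f) :
    Function.Surjective (LDual.map f) := fun φ =>
  (exists_character_extension f.toAddMonoidHom hf φ).imp fun _ h => LDual.ext h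

theorem RDual.map_surjective (f : M →ₗ[R] N) (hf : Function.Injective f) :
    Function.Surjective (RDual.map f) := fun φ =>
  (exists_character_extension f.toAddMonoidHom hf φ).imp fun _ h => RDual.ext h

theorem RDual.map_injective (f : M →ₗ[R] N) (hf : Function.Surjective f) :
    Function.Injective (RDual.map f) := fun φ ψ h => RDual.ext fun x => by
  obtain ⟨y, rfl⟩ := hf x
  exact DFunLike.congr_fun h y

theorem RDual.map_exact {K : Type*} [AddCommGroup K] [Module R K] (f : K →ₗ[R] M)
    (g : M →ₗ[R] N) (h : Function.Exact f g) :
    Function.Exact (RDual.map g) (RDual.map f) := by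
  intro φ
  refine ⟨fun hφ => ?_, ?_⟩
  · obtain ⟨ψ, hψ⟩ := exists_character_factor g.toAddMonoidHom φ fun b hb => by
      obtain ⟨a, rfl⟩ := (h b).1 hb
      exact DFunLike.congr_fun hφ a
    exact ⟨ψ, RDual.ext hψ⟩
  · rintro ⟨ψ, rfl⟩
    ext x
    simp [h.apply_apply_eq_zero]

/-- `Hom(M, J⁺) → Hom(J, M⁺)`. -/
noncomputable def flipRight (φ : M →ₗ[R] LDual R J) : J →ₗ[Rᵐᵒᵖ] RDual R M where
  toFun x := { toFun m := φ m x, map_zero' := by simp, map_add' := by simp }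
  map_add' x y := RDual.ext fun m => map_add (φ m) x y
  map_smul' r x := RDual.ext fun m => by
    change φ m (r • x) = φ (r.unop • m) x
    simp

/-- `Hom(J, M⁺) → Hom(M, J⁺)`. -/
noncomputable def flipLeft (φ : J →ₗ[Rᵐᵒᵖ] RDual R M) : M →ₗ[R] LDual R J where
  toFun m := { toFun x := φ x m, map_zero' := by simp, map_add' := by simp }
  map_add' x y := LDual.ext fun m => map_add (φ m) x y
  map_smul' r x := LDual.ext fun m => by
    change φ m (r • x) = φ (MulOpposite.op r • m) x
    simp

@[simp] theorem flipRight_apply (φ : M →ₗ[R] LDual R J) (x : J) (m : M) :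
    flipRight φ x m = φ m x := rfl

@[simp] theorem flipLeft_apply (φ : J →ₗ[Rᵐᵒᵖ] RDual R M) (x : J) (m : M) :
    flipLeft φ m x = φ x m := rfl

/-- The canonical map into the double dual. -/
noncomputable def LDual.eval (R : Type*) [Ring R] (M : Type*) [AddCommGroup M] [Module R M] :
    M →ₗ[R] LDual R (RDual R M) := flipLeft LinearMap.id

@[simp] theorem LDual.eval_apply (m : M) (φ : RDual R M) : LDual.eval R M m φ = φ m := rfl

theorem LDual.eval_injective : Function.Injective (LDual.eval R M) :=
  (injective_iff_map_eq_zero _).2 fun _ hm =>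
    eq_zero_of_character fun c => DFunLike.congr_fun hm (show RDual R M from c)

end Duals

/-! ### Characters of the balanced tensor product. -/

section TensorCharacters

variable {R : Type*} [Ring R]
  {I J : Type*} [AddCommGroup I] [Module Rᵐᵒᵖ I] [AddCommGroup J] [Module Rᵐᵒᵖ J]
  {M N : Type*} [AddCommGroup M] [Module R M] [AddCommGroup N] [Module R N]

variable (R) in
/-- The class of `x ⊗ m`. -/
noncomputable def BalancedTensor.tmul (x : I) (m : M) : BalancedTensor R I M :=
  QuotientAddGroup.mk (x ⊗ₜ[ℤ] m)

@[simp] theorem BalancedTensor.map_tmul (f : I →ₗ[Rᵐᵒᵖ] J) (g : M →ₗ[R] N) (x : I) (m : M) :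
    BalancedTensor.map f g (BalancedTensor.tmul R x m) = BalancedTensor.tmul R (f x) (g m) := rfl

theorem BalancedTensor.hom_ext {A : Type*} [AddCommGroup A] {c d : BalancedTensor R I M →+ A}
    (h : ∀ x m, c (BalancedTensor.tmul R x m) = d (BalancedTensor.tmul R x m)) : c = d := by
  refine QuotientAddGroup.addMonoidHom_ext _ ?_
  have := TensorProduct.ext' (R := ℤ) (M := I) (N := M)
    (g := (c.comp (QuotientAddGroup.mk' _)).toIntLinearMap)
    (h := (d.comp (QuotientAddGroup.mk' _)).toIntLinearMap) h
  exact AddMonoidHom.ext fun t => LinearMap.congr_fun this t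

theorem BalancedTensor.smul_tmul (r : R) (x : I) (m : M) :
    BalancedTensor.tmul R (MulOpposite.op r • x) m = BalancedTensor.tmul R x (r • m) := by
  rw [← sub_eq_zero]
  exact (QuotientAddGroup.eq_zero_iff
    ((MulOpposite.op r • x) ⊗ₜ[ℤ] m - x ⊗ₜ[ℤ] (r • m))).2
    (AddSubgroup.subset_closure ⟨x, r, m, rfl⟩)

theorem BalancedTensor.add_tmul (x y : I) (m : M) : BalancedTensor.tmul R (x + y) m =
    BalancedTensor.tmul R x m + BalancedTensor.tmul R y m :=
  congrArg QuotientAddGroup.mk (TensorProduct.add_tmul x y m)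

theorem BalancedTensor.tmul_add (x : I) (m n : M) : BalancedTensor.tmul R x (m + n) =
    BalancedTensor.tmul R x m + BalancedTensor.tmul R x n :=
  congrArg QuotientAddGroup.mk (TensorProduct.tmul_add x m n)

/-- The homomorphism `M → J⁺` attached to a character of `J ⊗ M`. -/
noncomputable def homOfCharacter (c : BalancedTensor R J M →+ AddCircle (1 : ℚ)) :
    M →ₗ[R] LDual R J where
  toFun m := AddMonoidHom.mk' (fun x => c (BalancedTensor.tmul R x m)) fun x y => by
    rw [BalancedTensor.add_tmul, map_add]
  map_add' m n := LDual.ext fun x =>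
    (congrArg c (BalancedTensor.tmul_add x m n)).trans (map_add c _ _)
  map_smul' r m := LDual.ext fun x => congrArg c (BalancedTensor.smul_tmul r x m).symm

@[simp] theorem homOfCharacter_apply (c : BalancedTensor R J M →+ AddCircle (1 : ℚ)) (m : M)
    (x : J) : homOfCharacter c m x = c (BalancedTensor.tmul R x m) := rfl

theorem exists_characterOfHom (φ : M →ₗ[R] LDual R J) :
    ∃ c : BalancedTensor R J M →+ AddCircle (1 : ℚ),
      ∀ x m, c (BalancedTensor.tmul R x m) = φ m x := by
  let t : J ⊗[ℤ] M →+ AddCircle (1 : ℚ) := TensorProduct.liftAddHom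
    (AddMonoidHom.mk' (fun x => AddMonoidHom.mk' (fun m => φ m x) (by simp))
      fun x y => AddMonoidHom.ext fun m => map_add (φ m) x y)
    (fun n x m => by
      change φ m (n • x) = φ (n • m) x
      rw [map_zsmul, map_zsmul]
      rfl)
  refine ⟨QuotientAddGroup.lift _ t ((AddSubgroup.closure_le _).2 ?_), fun x m => rfl⟩
  rintro _ ⟨x, r, m, rfl⟩
  change t _ = 0
  rw [map_sub]
  change φ m (MulOpposite.op r • x) - φ (r • m) x = 0
  simp

theorem injective_map_id_right_iff (f : I →ₗ[Rᵐᵒᵖ] J) :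
    Function.Injective (BalancedTensor.map f (LinearMap.id : M →ₗ[R] M)) ↔
      ∀ φ : I →ₗ[Rᵐᵒᵖ] RDual R M, ∃ ψ : J →ₗ[Rᵐᵒᵖ] RDual R M, ∀ x, ψ (f x) = φ x := by
  rw [injective_iff_character]
  constructor
  · intro h φ
    obtain ⟨c, hc⟩ := exists_characterOfHom (flipLeft φ)
    obtain ⟨d, hd⟩ := h c
    refine ⟨flipRight (homOfCharacter d), fun x => RDual.ext fun m => ?_⟩
    simpa [hc] using hd (BalancedTensor.tmul R x m)
  · intro h c
    obtain ⟨ψ, hψ⟩ := h (flipRight (homOfCharacter c))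
    obtain ⟨d, hd⟩ := exists_characterOfHom (flipLeft ψ)
    refine ⟨d, fun a => DFunLike.congr_fun
      (f := d.comp (BalancedTensor.map f LinearMap.id)) (g := c)
      (BalancedTensor.hom_ext fun x m => ?_) a⟩
    simp [hd, hψ]

theorem exact_map_id_left_iff {P : Type*} [AddCommGroup P] [Module R P] (f : M →ₗ[R] N)
    (g : N →ₗ[R] P) (hgf : ∀ m, g (f m) = 0) :
    Function.Exact (BalancedTensor.map (LinearMap.id : J →ₗ[Rᵐᵒᵖ] J) f)
      (BalancedTensor.map (LinearMap.id : J →ₗ[Rᵐᵒᵖ] J) g) ↔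
      ∀ φ : N →ₗ[R] LDual R J, (∀ m, φ (f m) = 0) →
        ∃ ψ : P →ₗ[R] LDual R J, ∀ n, ψ (g n) = φ n := by
  rw [exact_iff_character]
  · constructor
    · intro h φ hφ
      obtain ⟨c, hc⟩ := exists_characterOfHom φ
      obtain ⟨d, hd⟩ := h c fun a => DFunLike.congr_fun
        (f := c.comp (BalancedTensor.map LinearMap.id f)) (g := 0)
        (BalancedTensor.hom_ext fun x m => by simp [hc, hφ]) a
      refine ⟨homOfCharacter d, fun n => LDual.ext fun x => ?_⟩
      simpa [hc] using hd (BalancedTensor.tmul R x n)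
    · intro h c hc
      obtain ⟨ψ, hψ⟩ := h (homOfCharacter c) fun m => LDual.ext fun x =>
        hc (BalancedTensor.tmul R x m)
      obtain ⟨d, hd⟩ := exists_characterOfHom ψ
      refine ⟨d, fun a => DFunLike.congr_fun
        (f := d.comp (BalancedTensor.map LinearMap.id g)) (g := c)
        (BalancedTensor.hom_ext fun x m => ?_) a⟩
      simp [hd, hψ]
  · intro a
    refine DFunLike.congr_fun (f := (BalancedTensor.map (LinearMap.id : J →ₗ[Rᵐᵒᵖ] J) g).comp
      (BalancedTensor.map LinearMap.id f)) (g := 0) (BalancedTensor.hom_ext fun x m => ?_) a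
    simp only [AddMonoidHom.comp_apply, BalancedTensor.map_tmul, hgf, AddMonoidHom.zero_apply]
    simpa using BalancedTensor.tmul_add (R := R) x (0 : P) 0

end TensorCharacters

/-! ### Vanishing of Ext along short exact sequences. -/

section ExtVanishing

open CategoryTheory

/-- `Ext^n(M, X) = 0`. -/
def ExtVanishes (R : Type u) [Ring R] (M X : Type u) [AddCommGroup M] [Module R M]
    [AddCommGroup X] [Module R X] (n : ℕ) : Prop :=
  Subsingleton (Abelian.Ext (ModuleCat.of R M) (ModuleCat.of R X) n)

/-- A short exact sequence of modules. -/
structure IsShortExact {R : Type*} [Ring R] {A B C : Type*} [AddCommGroup A] [AddCommGroup B]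
    [AddCommGroup C] [Module R A] [Module R B] [Module R C] (f : A →ₗ[R] B) (g : B →ₗ[R] C) :
    Prop where
  injective : Function.Injective f
  exact : Function.Exact f g
  surjective : Function.Surjective g

variable {R : Type u} [Ring R] {A B C X : Type u} [AddCommGroup A] [AddCommGroup B]
    [AddCommGroup C] [AddCommGroup X] [Module R A] [Module R B] [Module R C] [Module R X]
    {f : A →ₗ[R] B} {g : B →ₗ[R] C}

theorem IsShortExact.shortExact (h : IsShortExact f g) :
    (ShortComplex.mk (ModuleCat.ofHom f) (ModuleCat.ofHom g) (by
      ext x; exact h.exact.apply_apply_eq_zero x)).ShortExact :=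
  ModuleCat.shortComplex_shortExact _ h.exact h.injective h.surjective

theorem ExtVanishes.middle (h : IsShortExact f g) {n : ℕ} (hA : ExtVanishes R A X n)
    (hC : ExtVanishes R C X n) : ExtVanishes R B X n := by
  refine subsingleton_of_forall_eq 0 fun x => ?_
  obtain ⟨y, rfl⟩ := Abelian.Ext.contravariant_sequence_exact₂ h.shortExact _ x (hA.elim _ _)
  rw [hC.elim y 0, Abelian.Ext.comp_zero]

theorem ExtVanishes.left (h : IsShortExact f g) {n : ℕ} (hB : ExtVanishes R B X n)
    (hC : ExtVanishes R C X (n + 1)) : ExtVanishes R A X n := by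
  refine subsingleton_of_forall_eq 0 fun x => ?_
  obtain ⟨y, rfl⟩ := Abelian.Ext.contravariant_sequence_exact₁ h.shortExact _ x
    (add_comm 1 n) (hC.elim _ _)
  rw [hB.elim y 0, Abelian.Ext.comp_zero]

theorem ExtVanishes.right (h : IsShortExact f g) {n : ℕ} (hA : ExtVanishes R A X n)
    (hB : ExtVanishes R B X (n + 1)) : ExtVanishes R C X (n + 1) := by
  refine subsingleton_of_forall_eq 0 fun x => ?_
  obtain ⟨y, rfl⟩ := Abelian.Ext.contravariant_sequence_exact₃ h.shortExact _ x
    (hB.elim _ _) (add_comm 1 n)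
  rw [hA.elim y 0, Abelian.Ext.comp_zero]

theorem ExtVanishes.exists_extension (h : IsShortExact f g) (hC : ExtVanishes R C X 1)
    (φ : A →ₗ[R] X) : ∃ ψ : B →ₗ[R] X, ∀ a, ψ (f a) = φ a := by
  obtain ⟨y, hy⟩ := Abelian.Ext.contravariant_sequence_exact₁ h.shortExact _
    (Abelian.Ext.mk₀ (ModuleCat.ofHom φ)) (add_comm 1 0) (hC.elim _ _)
  obtain ⟨ψ, rfl⟩ := (Abelian.Ext.mk₀_bijective _ _).2 y
  rw [Abelian.Ext.mk₀_comp_mk₀] at hy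
  have := (Abelian.Ext.mk₀_bijective _ _).1 hy
  exact ⟨ψ.hom, fun a => congr($(this) a)⟩

theorem ExtVanishes.one_of_extension (h : IsShortExact f g) (hB : ExtVanishes R B X 1)
    (H : ∀ φ : A →ₗ[R] X, ∃ ψ : B →ₗ[R] X, ∀ a, ψ (f a) = φ a) : ExtVanishes R C X 1 := by
  refine subsingleton_of_forall_eq 0 fun x => ?_
  obtain ⟨y, rfl⟩ := Abelian.Ext.contravariant_sequence_exact₃ h.shortExact _ x
    (hB.elim _ _) (add_comm 1 0)
  obtain ⟨φ, rfl⟩ := (Abelian.Ext.mk₀_bijective _ _).2 y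
  obtain ⟨ψ, hψ⟩ := H φ.hom
  have : φ = ModuleCat.ofHom f ≫ ModuleCat.ofHom ψ := by
    ext a; exact (hψ a).symm
  rw [this, ← Abelian.Ext.mk₀_comp_mk₀]
  exact h.shortExact.extClass_comp_assoc _

theorem ExtVanishes.of_projective [Module.Projective R A] (n : ℕ) :
    ExtVanishes R A X (n + 1) := by
  have : Projective (ModuleCat.of R A) := (IsProjective.iff_projective A).1 inferInstance
  exact Abelian.Ext.subsingleton_of_projective _ _ _

theorem ExtVanishes.of_subsingleton [Subsingleton A] (n : ℕ) : ExtVanishes R A X n := by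
  have h : Limits.IsZero (ModuleCat.of R A) := ModuleCat.isZero_of_subsingleton _
  refine subsingleton_of_forall_eq 0 fun x => ?_
  rw [← Abelian.Ext.mk₀_id_comp x, h.eq_of_src (𝟙 _) 0, Abelian.Ext.mk₀_zero,
    Abelian.Ext.zero_comp]

end ExtVanishing

/-! ### Short exact sequences and projective covers. -/

section ShortExact

variable {R : Type*} [Ring R] {A B C : Type*} [AddCommGroup A] [AddCommGroup B]
    [AddCommGroup C] [Module R A] [Module R B] [Module R C]

theorem isShortExact_ker (g : B →ₗ[R] C) (hg : Function.Surjective g) :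
    IsShortExact (LinearMap.ker g).subtype g :=
  ⟨Subtype.val_injective, LinearMap.exact_subtype_ker_map g, hg⟩

theorem isShortExact_mkQ (f : A →ₗ[R] B) (hf : Function.Injective f) :
    IsShortExact f (LinearMap.range f).mkQ :=
  ⟨hf, LinearMap.exact_map_mkQ_range f, Submodule.mkQ_surjective _⟩

theorem exists_linear_factor {f : A →ₗ[R] B} {h : A →ₗ[R] C} (hf : Function.Surjective f)
    (hker : ∀ a, f a = 0 → h a = 0) : ∃ k : B →ₗ[R] C, ∀ a, k (f a) = h a := by
  refine ⟨(LinearMap.ker f).liftQ h hker ∘ₗ (f.quotKerEquivOfSurjective hf).symm, fun a => ?_⟩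
  have : (f.quotKerEquivOfSurjective hf).symm (f a) = Submodule.Quotient.mk a := by
    rw [LinearEquiv.symm_apply_eq]
    rfl
  rw [LinearMap.comp_apply, LinearEquiv.coe_coe, this]
  rfl

theorem exists_projective_cover (R : Type u) [Ring R] (M : Type u) [AddCommGroup M] [Module R M] :
    ∃ (P : ModuleCat.{u} R) (π : P →ₗ[R] M), Module.Projective R P ∧ Function.Surjective π :=
  ⟨ModuleCat.of R (M →₀ R), Finsupp.linearCombination R id,
    inferInstanceAs (Module.Projective R (M →₀ R)),
    Finsupp.linearCombination_id_surjective R M⟩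

end ShortExact

/-! ### Flatness through injectivity of the dual and through Ext. -/

section Flat

variable {R : Type u} [Ring R] {K P M : Type u} [AddCommGroup K] [AddCommGroup P]
    [AddCommGroup M] [Module R K] [Module R P] [Module R M] {f : K →ₗ[R] P} {g : P →ₗ[R] M}

theorem isFlat_iff_injective : IsFlat R M ↔ Module.Injective Rᵐᵒᵖ (RDual R M) := by
  constructor
  · intro h
    exact ⟨fun X Y _ _ _ _ f hf φ => (injective_map_id_right_iff f).1 (h X Y f hf) φ⟩
  · intro h I J _ _ _ _ f hf
    exact (injective_map_id_right_iff f).2 fun φ => h.out f hf φ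

theorem IsFlat.of_projective [Module.Projective R P] : IsFlat R P := by
  intro I J _ _ _ _ f hf
  refine (injective_map_id_right_iff f).2 fun φ => ?_
  obtain ⟨ψ, hψ⟩ := Module.projective_lifting_property (LDual.map f) (flipLeft φ)
    (LDual.map_surjective f hf)
  refine ⟨flipRight ψ, fun x => RDual.ext fun m => ?_⟩
  exact DFunLike.congr_fun (LinearMap.congr_fun hψ m) x

/-- Since M⁺ is injective, the dual sequence 0 → M⁺ → P⁺ → K⁺ → 0 splits. -/
theorem IsFlat.exists_section_dual (h : IsShortExact f g) (hM : IsFlat R M) :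
    ∃ s : RDual R K →ₗ[Rᵐᵒᵖ] RDual R P, ∀ x, RDual.map f (s x) = x := by
  obtain ⟨r, hr⟩ := (isFlat_iff_injective.1 hM).out (RDual.map g)
    (RDual.map_injective g h.surjective) LinearMap.id
  have T := (RDual.map_exact f g h.exact).split_tfae'.out 0 1
  obtain ⟨-, s, hs⟩ := T.2 ⟨RDual.map_surjective f h.injective, r, LinearMap.ext hr⟩
  exact ⟨s, LinearMap.congr_fun hs⟩

theorem IsFlat.ker (h : IsShortExact f g) (hP : IsFlat R P) (hM : IsFlat R M) : IsFlat R K := by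
  obtain ⟨s, hs⟩ := hM.exists_section_dual h
  refine isFlat_iff_injective.2 ⟨fun X Y _ _ _ _ i hi φ => ?_⟩
  obtain ⟨ψ, hψ⟩ := (isFlat_iff_injective.1 hP).out i hi (s ∘ₗ φ)
  exact ⟨RDual.map f ∘ₗ ψ, fun x => by simp [hψ, hs]⟩

theorem IsFlat.extVanishes (hM : IsFlat R M) (J : Type u) [AddCommGroup J] [Module Rᵐᵒᵖ J]
    (n : ℕ) : ExtVanishes R M (LDual R J) (n + 1) := by
  induction n generalizing M with
  | zero =>
    obtain ⟨P, π, hP, hπ⟩ := exists_projective_cover R M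
    have hs := isShortExact_ker π hπ
    obtain ⟨s, hs'⟩ := hM.exists_section_dual hs
    refine ExtVanishes.one_of_extension hs (.of_projective 0) fun φ => ?_
    -- A map K → J⁺ is a map J → K⁺; the section K⁺ → P⁺ lifts it to J → P⁺, that is, P → J⁺.
    refine ⟨flipLeft (s ∘ₗ flipRight φ), fun a => LDual.ext fun x => ?_⟩
    exact DFunLike.congr_fun (hs' (flipRight φ x)) a
  | succ n ih =>
    obtain ⟨P, π, hP, hπ⟩ := exists_projective_cover R M
    have hs := isShortExact_ker π hπ
    exact .right hs (ih (.ker hs .of_projective hM)) (.of_projective _)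

/-- The single test map K → K⁺⁺ suffices: its extension to P, flipped, is a section of P⁺ → K⁺. So
M⁺ is a direct summand of the injective module P⁺. -/
theorem IsFlat.of_extension (h : IsShortExact f g) (hP : IsFlat R P)
    (H : ∀ (J : Type u) [AddCommGroup J] [Module Rᵐᵒᵖ J] (φ : K →ₗ[R] LDual R J),
      ∃ ψ : P →ₗ[R] LDual R J, ∀ a, ψ (f a) = φ a) : IsFlat R M := by
  obtain ⟨ψ, hψ⟩ := H (RDual R K) (LDual.eval R K)
  have T := (RDual.map_exact f g h.exact).split_tfae'.out 0 1
  obtain ⟨-, r, hr⟩ := T.1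
    ⟨RDual.map_injective g h.surjective, flipRight ψ, LinearMap.ext fun x => RDual.ext fun a =>
      DFunLike.congr_fun (hψ a) x⟩
  refine isFlat_iff_injective.2 ⟨fun X Y _ _ _ _ i hi φ => ?_⟩
  obtain ⟨χ, hχ⟩ := (isFlat_iff_injective.1 hP).out i hi (RDual.map g ∘ₗ φ)
  exact ⟨r ∘ₗ χ, fun x => by simpa [hχ] using LinearMap.congr_fun hr (φ x)⟩

theorem isFlat_iff_extVanishes : IsFlat R M ↔
    ∀ (J : Type u) [AddCommGroup J] [Module Rᵐᵒᵖ J], ExtVanishes R M (LDual R J) 1 := by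
  refine ⟨fun h J _ _ => h.extVanishes J 0, fun h => ?_⟩
  obtain ⟨P, π, hP, hπ⟩ := exists_projective_cover R M
  have hs := isShortExact_ker π hπ
  exact .of_extension hs .of_projective fun J _ _ φ => (h J).exists_extension hs φ

theorem IsFlat.middle (h : IsShortExact f g) (hK : IsFlat R K) (hM : IsFlat R M) : IsFlat R P :=
  isFlat_iff_extVanishes.2 fun J _ _ =>
    .middle h (isFlat_iff_extVanishes.1 hK J) (isFlat_iff_extVanishes.1 hM J)

end Flat

/-! ### Finite weak dimension bounds Ext into dual modules. -/

section WeakDimension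

variable {R : Type u} [Ring R]

theorem HasFlatResolution.extVanishes {M : Type u} [AddCommGroup M] [Module R M] {n : ℕ}
    (h : HasFlatResolution R M n) (J : Type u) [AddCommGroup J] [Module Rᵐᵒᵖ J] {m : ℕ}
    (hm : n + 2 ≤ m) : ExtVanishes R M (LDual R J) m := by
  obtain ⟨F, d, ε, hF, hε, h0, hd, hn⟩ := h
  -- Induction from the top: the image of `d n` is zero because `F (n + 1)` is. The bound `n + 2` is
  -- not sharp; only its finiteness matters.
  have key : ∀ k i, i + k = n → ∀ m, k + 1 ≤ m →
      ExtVanishes R (LinearMap.range (d i)) (LDual R J) m := by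
    intro k
    induction k with
    | zero =>
      rintro i rfl m -
      have := hn (i + 1) (by omega)
      have : Subsingleton (LinearMap.range (d i)) :=
        (LinearMap.surjective_rangeRestrict (d i)).subsingleton
      exact .of_subsingleton m
    | succ k ih =>
      intro i hi m hm
      obtain ⟨m, rfl⟩ : ∃ m', m = m' + 1 := ⟨m - 1, by omega⟩
      have hs := isShortExact_ker (d i).rangeRestrict (LinearMap.surjective_rangeRestrict _)
      have e : LinearMap.ker (d i).rangeRestrict = LinearMap.range (d (i + 1)) := by
        rw [LinearMap.ker_rangeRestrict]
        exact LinearMap.exact_iff.1 (hd i)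
      refine .right hs ?_ ((hF _).extVanishes J m)
      rw [e]
      exact ih (i + 1) (by omega) m (by omega)
  obtain ⟨m, rfl⟩ : ∃ m', m = m' + 1 := ⟨m - 1, by omega⟩
  refine .right (isShortExact_ker ε hε) ?_ ((hF _).extVanishes J m)
  rw [LinearMap.exact_iff.1 h0]
  exact key n 0 (by omega) m (by omega)

theorem exists_extVanishes_of_weakDim_lt_top (h : weakDim R < ⊤) :
    ∃ N : ℕ, ∀ (M J : Type u) [AddCommGroup M] [Module R M] [AddCommGroup J] [Module Rᵐᵒᵖ J]
      (m : ℕ), N ≤ m → ExtVanishes R M (LDual R J) m := by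
  obtain ⟨n, hn⟩ := ENat.ne_top_iff_exists.1 h.ne
  refine ⟨n + 2, fun M J _ _ _ _ m hm => ?_⟩
  have hM : flatDim R M ≤ n := hn ▸ le_iSup (fun M : ModuleCat.{u} R => flatDim R M)
    (ModuleCat.of R M)
  unfold flatDim at hM
  -- The infimum of the empty set is `⊤`, so a finite value yields an actual resolution.
  have hne : {k : ℕ∞ | ∃ n : ℕ, k = n ∧ HasFlatResolution R M n}.Nonempty := by
    by_contra hne
    rw [Set.not_nonempty_iff_eq_empty] at hne
    rw [hne, sInf_empty] at hM
    exact ENat.natCast_ne_top n (top_le_iff.1 hM)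
  obtain ⟨k, hk, hres⟩ := csInf_mem hne
  rw [hk, Nat.cast_le] at hM
  exact hres.extVanishes J (by omega)

end WeakDimension

/-- Iterates chosen successors and predecessors of `x`; it serves to splice right and left steps
into one chain. -/
theorem exists_int_chain {α : Type*} (S : α → Prop) (r : α → α → Prop)
    (hr : ∀ x, S x → ∃ y, S y ∧ r x y) (hl : ∀ x, S x → ∃ y, S y ∧ r y x) (x : α) (hx : S x) :
    ∃ s : ℤ → α, s 1 = x ∧ (∀ i, S (s i)) ∧ ∀ i, r (s i) (s (i + 1)) := by
  choose! R hRS hRr using hr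
  choose! L hLS hLr using hl
  have hRn : ∀ n : ℕ, S (R^[n] x) := fun n => by
    induction n with
    | zero => exact hx
    | succ n ih => rw [Function.iterate_succ_apply']; exact hRS _ ih
  have hLn : ∀ n : ℕ, S (L^[n] x) := fun n => by
    induction n with
    | zero => exact hx
    | succ n ih => rw [Function.iterate_succ_apply']; exact hLS _ ih
  let s : ℤ → α := fun i => match i with
    | .ofNat n => R^[n] x
    | .negSucc n => L^[n + 1] x
  suffices h : (∀ i, S (s i)) ∧ ∀ i, r (s i) (s (i + 1)) from
    -- The shift puts `x` at index 1, matching the image of `F 0 → F 1`.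
    ⟨fun i => s (i - 1), rfl, fun i => h.1 _, fun i => by
      have := h.2 (i - 1)
      rwa [sub_add_eq_add_sub] at this⟩
  constructor
  · rintro (n | n)
    exacts [hRn n, hLn (n + 1)]
  · rintro (n | n)
    · change r (R^[n] x) (R^[n + 1] x)
      rw [Function.iterate_succ_apply']
      exact hRr _ (hRn n)
    · rcases n with - | n
      · exact hLr x hx
      · change r (L^[n + 1 + 1] x) (L^[n + 1] x)
        rw [Function.iterate_succ_apply']
        exact hLr _ (hLn (n + 1))

/-! ### Gorenstein flat modules as terms of ℤ-indexed chains. -/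

section GorensteinFlat

variable {R : Type u} [Ring R]

/-- There is a short exact sequence `0 → A → F → B → 0` with `F` flat. -/
def FlatStep (A B : ModuleCat.{u} R) : Prop :=
  ∃ (F : ModuleCat.{u} R) (ι : A →ₗ[R] F) (π : F →ₗ[R] B), IsFlat R F ∧ IsShortExact ι π

variable (R) in
/-- `Ext^n(M, I⁺) = 0` for every injective right module `I`. -/
def InjExtVanishes (M : Type u) [AddCommGroup M] [Module R M] (n : ℕ) : Prop :=
  ∀ (I : Type u) [AddCommGroup I] [Module Rᵐᵒᵖ I], Module.Injective Rᵐᵒᵖ I →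
    ExtVanishes R M (LDual R I) n

theorem IsGorensteinFlat.exists_chain {M : Type u} [AddCommGroup M] [Module R M]
    (h : IsGorensteinFlat R M) :
    ∃ Z : ℤ → ModuleCat.{u} R, (∀ i, FlatStep (Z i) (Z (i + 1))) ∧
      (∀ i, InjExtVanishes R (Z i) 1) ∧ Nonempty (M ≃ₗ[R] Z 1) := by
  obtain ⟨F, d, hF, hd, hI, ⟨e⟩⟩ := h
  let π : ∀ i, F i →ₗ[R] LinearMap.ker (d (i + 1)) := fun i =>
    (d i).codRestrict _ fun x => (hd i).apply_apply_eq_zero x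
  have hπ : ∀ i, IsShortExact (LinearMap.ker (d i)).subtype (π i) := fun i => by
    have := isShortExact_ker (π i) fun ⟨y, hy⟩ => by
      obtain ⟨x, rfl⟩ := (hd i y).1 hy
      exact ⟨x, rfl⟩
    rwa [show LinearMap.ker (π i) = LinearMap.ker (d i) from LinearMap.ker_codRestrict _ _ _] at this
  refine ⟨fun i => ModuleCat.of R (LinearMap.ker (d i)),
    fun i => ⟨F i, _, π i, hF i, hπ i⟩, fun i I _ _ hinj => ?_,
    ⟨e.trans (LinearEquiv.ofEq _ _ (LinearMap.exact_iff.1 (hd 0)).symm)⟩⟩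
  -- Ext¹ of the kernel in degree k + 3 concerns extending maps from the kernel in degree k + 2 to
  -- `F (k + 2)`. This is tensor exactness at `F (k + 1)`, where `d k` arrives.
  obtain ⟨k, rfl⟩ : ∃ k, i = k + 1 + 1 + 1 := ⟨i - 3, by ring⟩
  refine .one_of_extension (hπ _) ((hF _).extVanishes I 0) fun φ => ?_
  obtain ⟨ψ, hψ⟩ := (exact_map_id_left_iff (J := I) (d k) (d (k + 1))
    (hd k).apply_apply_eq_zero).1 (hI I hinj k) (φ ∘ₗ π (k + 1)) fun m => by
      have : π (k + 1) (d k m) = 0 := Subtype.ext ((hd k).apply_apply_eq_zero m)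
      simp [this]
  refine ⟨ψ, fun a => ?_⟩
  obtain ⟨b, rfl⟩ := (hπ (k + 1)).surjective a
  exact hψ b

theorem IsGorensteinFlat.of_chain {M : Type u} [AddCommGroup M] [Module R M]
    (Z : ℤ → ModuleCat.{u} R) (hs : ∀ i, FlatStep (Z i) (Z (i + 1)))
    (hZ : ∀ i, InjExtVanishes R (Z i) 1) (e : M ≃ₗ[R] Z 1) : IsGorensteinFlat R M := by
  choose F ι π hF h using hs
  let d : ∀ i, F i →ₗ[R] F (i + 1) := fun i => (ι (i + 1)).comp (π i)
  have hd : ∀ (i : ℤ) (x : F i), d (i + 1) (d i x) = 0 := fun i x => by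
    simp [d, (h (i + 1)).exact.apply_apply_eq_zero]
  refine ⟨F, d, hF, fun i y => ⟨fun hy => ?_, ?_⟩,
    fun I _ _ hI i => ?_, ?_⟩
  · obtain ⟨z, rfl⟩ := ((h (i + 1)).exact y).1
      ((injective_iff_map_eq_zero _).1 (h (i + 1 + 1)).injective _ hy)
    obtain ⟨x, rfl⟩ := (h i).surjective z
    exact ⟨x, rfl⟩
  · rintro ⟨x, rfl⟩
    exact hd i x
  · refine (exact_map_id_left_iff _ _ (hd i)).2 fun φ hφ => ?_
    obtain ⟨χ, hχ⟩ := exists_linear_factor (f := π (i + 1)) (h := φ) (h (i + 1)).surjective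
      fun y hy => by
        obtain ⟨z, rfl⟩ := ((h (i + 1)).exact y).1 hy
        obtain ⟨x, rfl⟩ := (h i).surjective z
        exact hφ x
    obtain ⟨ψ, hψ⟩ := (hZ (i + 1 + 1 + 1) I hI).exists_extension (h (i + 1 + 1)) χ
    exact ⟨ψ, fun n => (hψ _).trans (hχ n)⟩
  · exact ⟨(e.trans (LinearEquiv.ofInjective (ι 1) (h 1).injective)).trans
      (LinearEquiv.ofEq _ _ (LinearMap.range_comp_of_range_eq_top (ι (0 + 1))
        (LinearMap.range_eq_top.2 (h 0).surjective)).symm)⟩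

theorem injExtVanishes_chain {Z : ℤ → ModuleCat.{u} R} (hs : ∀ i, FlatStep (Z i) (Z (i + 1)))
    (hZ : ∀ i, InjExtVanishes R (Z i) 1) (i : ℤ) (n : ℕ) : InjExtVanishes R (Z i) (n + 1) := by
  induction n generalizing i with
  | zero => exact hZ i
  | succ n ih =>
    intro I _ _ hI
    obtain ⟨j, rfl⟩ : ∃ j, i = j + 1 := ⟨i - 1, by ring⟩
    obtain ⟨F, ι, π, hF, h⟩ := hs j
    exact .right h (ih j I hI) (hF.extVanishes I _)

/-- Makes transport of Ext-vanishing along an isomorphism an instance of `ExtVanishes.middle`. -/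
theorem isShortExact_equiv {M N : Type*} [AddCommGroup M] [Module R M] [AddCommGroup N]
    [Module R N] (e : M ≃ₗ[R] N) : IsShortExact (0 : PUnit.{u + 1} →ₗ[R] M) e.toLinearMap := by
  refine ⟨fun _ _ _ => rfl, fun x => ⟨fun hx => ⟨0, ?_⟩, ?_⟩, e.surjective⟩
  · exact (e.map_eq_zero_iff.1 hx).symm
  · rintro ⟨_, rfl⟩
    simp

theorem ExtVanishes.congr {M N X : Type u} [AddCommGroup M] [Module R M] [AddCommGroup N]
    [Module R N] [AddCommGroup X] [Module R X] (e : M ≃ₗ[R] N) {n : ℕ}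
    (h : ExtVanishes R N X n) : ExtVanishes R M X n :=
  .middle (isShortExact_equiv e) (.of_subsingleton n) h

theorem IsGorensteinFlat.injExtVanishes {M : Type u} [AddCommGroup M] [Module R M]
    (h : IsGorensteinFlat R M) (n : ℕ) : InjExtVanishes R M (n + 1) := by
  obtain ⟨Z, hs, hZ, ⟨e⟩⟩ := h.exists_chain
  exact fun I _ _ hI => .congr e (injExtVanishes_chain hs hZ 1 n I hI)

theorem IsGorensteinFlat.exists_flat_embedding {M : Type u} [AddCommGroup M] [Module R M]
    (h : IsGorensteinFlat R M) : ∃ (F C : ModuleCat.{u} R) (ι : M →ₗ[R] F) (π : F →ₗ[R] C),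
      IsFlat R F ∧ IsGorensteinFlat R C ∧ IsShortExact ι π := by
  obtain ⟨Z, hs, hZ, ⟨e⟩⟩ := h.exists_chain
  obtain ⟨F, ι, π, hF, hx⟩ := hs 1
  refine ⟨F, Z (1 + 1), ι ∘ₗ e.toLinearMap, π, hF, ?_, ?_, ?_, hx.surjective⟩
  · refine .of_chain (fun i => Z (i + 1)) (fun i => hs (i + 1)) (fun i => hZ (i + 1)) (.refl R _)
  · exact hx.injective.comp e.injective
  · intro y
    rw [hx.exact y, LinearMap.coe_comp, LinearEquiv.coe_coe, e.surjective.range_comp]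

/-- The constant chain M → M × M → M works. -/
theorem IsFlat.isGorensteinFlat {M : Type u} [AddCommGroup M] [Module R M] (h : IsFlat R M) :
    IsGorensteinFlat R M := by
  have hx : IsShortExact (LinearMap.inl R M M) (LinearMap.snd R M M) :=
    ⟨LinearMap.inl_injective, .inl_snd, LinearMap.snd_surjective⟩
  exact .of_chain (fun _ => ModuleCat.of R M)
    (fun _ => ⟨ModuleCat.of R (M × M), _, _, .middle hx h h, hx⟩)
    (fun _ I _ _ _ => h.extVanishes I 0) (LinearEquiv.refl R M)

theorem IsGorensteinFlat.isFlat_of_weakDim {M : Type u} [AddCommGroup M] [Module R M]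
    (h : IsGorensteinFlat R M) (hw : weakDim R < ⊤) : IsFlat R M := by
  obtain ⟨N, hN⟩ := exists_extVanishes_of_weakDim_lt_top hw
  obtain ⟨Z, hs, -, ⟨e⟩⟩ := h.exists_chain
  refine isFlat_iff_extVanishes.2 fun J _ _ => .congr e ?_
  -- Each step to the right in the chain raises the Ext degree by one, until it reaches the range
  -- where everything vanishes.
  have key : ∀ n m : ℕ, N ≤ m + n → ∀ i, ExtVanishes R (Z i) (LDual R J) (m + 1) := by
    intro n
    induction n with
    | zero => exact fun m hm i => hN _ _ _ (by omega)
    | succ n ih =>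
      intro m hm i
      obtain ⟨F, ι, π, hF, hx⟩ := hs i
      exact .left hx (hF.extVanishes J m) (ih (m + 1) (by omega) _)
  exact key N 0 (by omega) 1

end GorensteinFlat

/-! ### Over a right coherent ring, duals of injectives are flat. -/

section Coherent

variable {R : Type u} [Ring R]

/-- Baer's criterion for M⁺: extending g : I → M⁺ means finding a character of M with r m ↦ g(r)(m).
The hypothesis shows that this prescription respects all relations ∑ rᵢ mᵢ = 0. -/
theorem IsFlat.of_equational {M : Type u} [AddCommGroup M] [Module R M]
    (H : ∀ (ι : Type u) [Fintype ι] (a : ι → R) (m : ι → M), ∑ i, a i • m i = 0 →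
      ∃ (κ : Type u) (_ : Fintype κ) (c : κ → ι → R) (y : κ → M),
        (∀ i, m i = ∑ j, c j i • y j) ∧ ∀ j, ∑ i, a i * c j i = 0) : IsFlat R M := by
  refine isFlat_iff_injective.2 (Module.Baer.injective fun I g => ?_)
  let p : (I →₀ M) →+ M :=
    Finsupp.liftAddHom fun r => DistribSMul.toAddMonoidHom M (r : Rᵐᵒᵖ).unop
  let c : (I →₀ M) →+ AddCircle (1 : ℚ) := Finsupp.liftAddHom fun r => g r
  obtain ⟨ψ, hψ⟩ := exists_character_factor p c fun b hb => by
    obtain ⟨κ, _, d, y, hm, hd⟩ := H b.support (fun i => (i : I).1.unop) (fun i => b i) (by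
      rw [Finset.sum_coe_sort b.support fun i => (i : Rᵐᵒᵖ).unop • b i]
      exact hb)
    have hc : c b = ∑ i : b.support, g i (b i) := by
      rw [Finset.sum_coe_sort b.support fun i => g i (b i)]
      rfl
    have key : ∀ j, ∑ i : b.support, g i (d j i • y j) = 0 := fun j => by
      have h1 : ∑ i : b.support, MulOpposite.op (d j i) • (i : I) = 0 := by
        apply Subtype.ext
        simpa [Finset.op_sum] using congrArg MulOpposite.op (hd j)
      have h2 := congrArg (fun z => g z (y j)) h1
      simpa [RDual.sum_apply] using h2
    rw [hc, Finset.sum_congr rfl fun i _ => by rw [hm i, map_sum], Finset.sum_comm]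
    exact Finset.sum_eq_zero fun j _ => key j
  refine ⟨LinearMap.toSpanSingleton Rᵐᵒᵖ _ (show RDual R M from ψ), fun r hr =>
    RDual.ext fun m => ?_⟩
  have := hψ (Finsupp.single ⟨r, hr⟩ m)
  rw [Finsupp.liftAddHom_apply_single] at this
  exact this.trans (Finsupp.liftAddHom_apply_single (fun r : I => (g r : M →+ AddCircle (1 : ℚ))) _ m)

theorem exists_extension_of_injective {S : Type u} [Ring S] {A B E : Type u} [AddCommGroup A]
    [AddCommGroup B] [AddCommGroup E] [Module S A] [Module S B] [Module S E]
    (hE : Module.Injective S E) (l : A →ₗ[S] B) (φ : A →ₗ[S] E)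
    (h : LinearMap.ker l ≤ LinearMap.ker φ) : ∃ ψ : B →ₗ[S] E, ∀ a, ψ (l a) = φ a := by
  obtain ⟨ψ, hψ⟩ := hE.out ((LinearMap.ker l).liftQ l le_rfl)
    (LinearMap.ker_eq_bot.1 (Submodule.ker_liftQ_eq_bot _ _ _ le_rfl))
    ((LinearMap.ker l).liftQ φ h)
  exact ⟨ψ, fun a => hψ (Submodule.Quotient.mk a)⟩

instance : Module.Finite Rᵐᵒᵖ R :=
  ⟨⟨{1}, by
    rw [Finset.coe_singleton, eq_top_iff]
    exact fun x _ => Submodule.mem_span_singleton.2 ⟨MulOpposite.op x, by simp⟩⟩⟩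

/-- The homomorphism of right modules `r ↦ ∑ e i r i`. -/
def finCombination (ι : Type*) [Fintype ι] {E : Type*} [AddCommGroup E] [Module Rᵐᵒᵖ E]
    (e : ι → E) : (ι → R) →ₗ[Rᵐᵒᵖ] E where
  toFun r := ∑ i, MulOpposite.op (r i) • e i
  map_add' r s := by simp [add_smul, Finset.sum_add_distrib]
  map_smul' t r := by
    simp only [Pi.smul_apply, RingHom.id_apply, Finset.smul_sum, smul_smul]
    rfl

/-- Given ∑ aᵢ φᵢ = 0 in E⁺, coherence makes the kernel of r ↦ ∑ aᵢ rᵢ finitely generated, say by S;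
these generators are the coefficients required by the equational criterion. -/
theorem IsRightCoherent.isFlat_dual (hR : IsRightCoherent R) {E : Type u} [AddCommGroup E]
    [Module Rᵐᵒᵖ E] (hE : Module.Injective Rᵐᵒᵖ E) : IsFlat R (LDual R E) := by
  classical
  refine .of_equational fun ι _ a φ hφ => ?_
  let l : (ι → R) →ₗ[Rᵐᵒᵖ] R := finCombination ι a
  have hfg : (LinearMap.range l).FG := LinearMap.range_eq_map l ▸ Module.Finite.fg_top.map l
  have := hR _ hfg
  obtain ⟨S, hS⟩ := Module.FinitePresentation.fg_ker l.rangeRestrict l.surjective_rangeRestrict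
  rw [LinearMap.ker_rangeRestrict] at hS
  let ρ : (ι → E) →+ (S → E) := AddMonoidHom.mk'
    (fun e s => finCombination ι e (s : ι → R)) fun e e' => by
      ext s; simp [finCombination, Finset.sum_add_distrib]
  let c : (ι → E) →+ AddCircle (1 : ℚ) := AddMonoidHom.mk' (fun e => ∑ i, φ i (e i))
    fun e e' => by simp [Finset.sum_add_distrib]
  -- If `e` is killed by the relations in S, injectivity of E gives x with eᵢ = x aᵢ. Then ∑ φᵢ(eᵢ)
  -- = (∑ aᵢ φᵢ)(x) = 0, so `c` factors through `ρ`; the components of `ψ` are the new elements of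
  -- E⁺.
  obtain ⟨ψ, hψ⟩ := exists_character_factor ρ c fun e he => by
    obtain ⟨χ, hχ⟩ := exists_extension_of_injective hE l (finCombination ι e) (by
      rw [← hS, Submodule.span_le]
      exact fun s hs => congrFun he ⟨s, hs⟩)
    have hei : ∀ i, e i = MulOpposite.op (a i) • χ 1 := fun i => by
      have := hχ (Pi.single i 1)
      rw [← map_smul]
      simpa [l, finCombination, Pi.single_apply, apply_ite MulOpposite.op, ite_smul] using this.symm
    have := DFunLike.congr_fun hφ (χ 1)
    rw [LDual.sum_apply] at this
    simpa [c, hei] using this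
  refine ⟨S, inferInstance, fun s i => (s : ι → R) i,
    fun s => AddMonoidHom.comp ψ (AddMonoidHom.single (fun _ => E) s), fun i => LDual.ext fun x => ?_,
    fun s => ?_⟩
  · have h1 := hψ (Pi.single i x)
    have h2 : ρ (Pi.single i x) = ∑ s : S, Pi.single s (MulOpposite.op ((s : ι → R) i) • x) := by
      ext s
      simp [ρ, finCombination, Finset.sum_apply, Pi.single_apply]
    have h3 : c (Pi.single i x) = φ i x := by
      simp [c, Pi.single_apply, apply_ite]
    rw [h2, h3, map_sum] at h1
    rw [LDual.sum_apply]
    exact h1.symm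
  · have : (s : ι → R) ∈ LinearMap.ker l := hS ▸ Submodule.subset_span s.2
    simpa [l, finCombination] using this

end Coherent

/-! ### Iterated extensions of Gorenstein flat modules; the closure theorems. -/

section Extensions

variable {R : Type u} [Ring R]

/-- Every φ : F → J⁺ extends to F⁺⁺, by dualizing the flipped map J → F⁺. -/
theorem IsFlat.quotient_eval {F : Type u} [AddCommGroup F] [Module R F]
    (h : IsFlat R (LDual R (RDual R F))) :
    IsFlat R (LDual R (RDual R F) ⧸ LinearMap.range (LDual.eval R F)) :=
  .of_extension (isShortExact_mkQ _ LDual.eval_injective) h fun _ _ _ φ =>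
    ⟨LDual.map (flipRight φ), fun _ => rfl⟩

theorem ExtVanishes.prod {D X Y : Type u} [AddCommGroup D] [AddCommGroup X] [AddCommGroup Y]
    [Module R D] [Module R X] [Module R Y] (hX : ExtVanishes R D X 1) (hY : ExtVanishes R D Y 1) :
    ExtVanishes R D (X × Y) 1 := by
  obtain ⟨P, π, hP, hπ⟩ := exists_projective_cover R D
  have hs := isShortExact_ker π hπ
  refine .one_of_extension hs (.of_projective 0) fun φ => ?_
  obtain ⟨ψ, hψ⟩ := hX.exists_extension hs (LinearMap.fst R X Y ∘ₗ φ)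
  obtain ⟨χ, hχ⟩ := hY.exists_extension hs (LinearMap.snd R X Y ∘ₗ φ)
  exact ⟨ψ.prod χ, fun a => Prod.ext (hψ a) (hχ a)⟩

variable (R) in
/-- The modules obtained from Gorenstein flat modules by iterated extensions. -/
inductive IsGFFiltered : ModuleCat.{u} R → Prop
  | base {M : ModuleCat.{u} R} (h : IsGorensteinFlat R M) : IsGFFiltered M
  | ext {A B C : ModuleCat.{u} R} {f : A →ₗ[R] B} {g : B →ₗ[R] C} (h : IsShortExact f g)
      (hA : IsGFFiltered A) (hC : IsGFFiltered C) : IsGFFiltered B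

theorem IsGFFiltered.injExtVanishes {M : ModuleCat.{u} R} (h : IsGFFiltered R M) (n : ℕ) :
    InjExtVanishes R M (n + 1) := by
  induction h with
  | base h => exact h.injExtVanishes n
  | ext h _ _ ihA ihC => exact fun I _ _ hI => .middle h (ihA I hI) (ihC I hI)

/-- If `0 → M → F → C → 0` is exact, then the cokernel of `M → F → G`, for an injective
homomorphism `η : F → G`, is an extension of `G / F` by `C`. -/
theorem exists_isShortExact_quotient_comp {M F C G : Type*} [AddCommGroup M] [AddCommGroup F]
    [AddCommGroup C] [AddCommGroup G] [Module R M] [Module R F] [Module R C] [Module R G]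
    {ι : M →ₗ[R] F} {π : F →ₗ[R] C} (h : IsShortExact ι π) (η : F →ₗ[R] G)
    (hη : Function.Injective η) :
    ∃ (α : C →ₗ[R] G ⧸ LinearMap.range (η ∘ₗ ι))
      (β : (G ⧸ LinearMap.range (η ∘ₗ ι)) →ₗ[R] G ⧸ LinearMap.range η), IsShortExact α β := by
  obtain ⟨α, hα⟩ := exists_linear_factor (f := π)
    (h := (LinearMap.range (η ∘ₗ ι)).mkQ ∘ₗ η) h.surjective fun x hx => by
      obtain ⟨m, rfl⟩ := (h.exact x).1 hx
      exact (Submodule.Quotient.mk_eq_zero _).2 ⟨m, rfl⟩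
  refine ⟨α, Submodule.factor (LinearMap.range_comp_le_range ι η),
    (injective_iff_map_eq_zero _).2 fun c hc => ?_, fun y => ⟨fun hy => ?_, ?_⟩,
    Submodule.factor_surjective _⟩
  · obtain ⟨x, rfl⟩ := h.surjective c
    obtain ⟨m, hm⟩ := (Submodule.Quotient.mk_eq_zero _).1 ((hα x).symm.trans hc)
    rw [← hη hm]
    exact h.exact.apply_apply_eq_zero m
  · obtain ⟨y, rfl⟩ := Submodule.mkQ_surjective _ y
    obtain ⟨x, rfl⟩ := (Submodule.Quotient.mk_eq_zero _).1 hy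
    exact ⟨π x, hα x⟩
  · rintro ⟨c, rfl⟩
    obtain ⟨x, rfl⟩ := h.surjective c
    rw [hα]
    exact (Submodule.Quotient.mk_eq_zero _).2 ⟨x, rfl⟩

/-- Horseshoe lemma for embeddings: the extension `θ` of `ι` to B plays the role of the lift in the
projective version. -/
theorem exists_isShortExact_quotient_prod {A B C F F' D D' : Type*} [AddCommGroup A]
    [AddCommGroup B] [AddCommGroup C] [AddCommGroup F] [AddCommGroup F'] [AddCommGroup D]
    [AddCommGroup D'] [Module R A] [Module R B] [Module R C] [Module R F] [Module R F']
    [Module R D] [Module R D'] {f : A →ₗ[R] B} {g : B →ₗ[R] C} (h : IsShortExact f g)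
    {ι : A →ₗ[R] F} {π : F →ₗ[R] D} (hA : IsShortExact ι π)
    {ι' : C →ₗ[R] F'} {π' : F' →ₗ[R] D'} (hC : IsShortExact ι' π')
    (θ : B →ₗ[R] F) (hθ : ∀ a, θ (f a) = ι a) :
    Function.Injective (θ.prod (ι' ∘ₗ g)) ∧
    ∃ (α : D →ₗ[R] (F × F') ⧸ LinearMap.range (θ.prod (ι' ∘ₗ g)))
      (β : ((F × F') ⧸ LinearMap.range (θ.prod (ι' ∘ₗ g))) →ₗ[R] D'), IsShortExact α β := by
  have key : ∀ b, ι' (g b) = 0 → ∃ a, f a = b := fun b hb =>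
    (h.exact b).1 ((injective_iff_map_eq_zero _).1 hC.injective _ hb)
  refine ⟨(injective_iff_map_eq_zero _).2 fun b hb => ?_, ?_⟩
  · obtain ⟨h1, h2⟩ := Prod.mk.inj hb
    obtain ⟨a, rfl⟩ := key b h2
    rw [(injective_iff_map_eq_zero _).1 hA.injective a ((hθ a).symm.trans h1), map_zero]
  · obtain ⟨α, hα⟩ := exists_linear_factor (f := π)
      (h := (LinearMap.range (θ.prod (ι' ∘ₗ g))).mkQ ∘ₗ LinearMap.inl R F F') hA.surjective
      fun x hx => by
        obtain ⟨a, rfl⟩ := (hA.exact x).1 hx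
        refine (Submodule.Quotient.mk_eq_zero _).2 ⟨f a, ?_⟩
        simp [hθ, h.exact.apply_apply_eq_zero]
    refine ⟨α, (LinearMap.range (θ.prod (ι' ∘ₗ g))).liftQ (π' ∘ₗ LinearMap.snd R F F') ?_,
      (injective_iff_map_eq_zero _).2 fun d hd => ?_, fun y => ⟨fun hy => ?_, ?_⟩, fun d => ?_⟩
    · rintro _ ⟨b, rfl⟩
      exact hC.exact.apply_apply_eq_zero (g b)
    · obtain ⟨x, rfl⟩ := hA.surjective d
      obtain ⟨b, hb⟩ := (Submodule.Quotient.mk_eq_zero _).1 ((hα x).symm.trans hd)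
      obtain ⟨h1, h2⟩ := Prod.mk.inj hb
      obtain ⟨a, rfl⟩ := key b h2
      rw [← show θ (f a) = x from h1, hθ]
      exact hA.exact.apply_apply_eq_zero a
    · obtain ⟨⟨x, z⟩, rfl⟩ := Submodule.mkQ_surjective _ y
      obtain ⟨c, rfl⟩ := (hC.exact z).1 hy
      obtain ⟨b, rfl⟩ := h.surjective c
      refine ⟨π (x - θ b), (hα _).trans ((Submodule.Quotient.eq _).2 ⟨-b, ?_⟩)⟩
      simp
    · rintro ⟨d, rfl⟩
      obtain ⟨x, rfl⟩ := hA.surjective d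
      rw [hα]
      exact map_zero π'
    · obtain ⟨z, rfl⟩ := hC.surjective d
      exact ⟨Submodule.Quotient.mk (0, z), rfl⟩

/-- The final clause, relative injectivity of F, is what carries the induction: for an extension of
C by A it extends the embedding of A over the middle term. In the base case it holds because F is
the dual of an injective module. -/
theorem IsGFFiltered.exists_flat_embedding (hR : IsRightCoherent R) {M : ModuleCat.{u} R}
    (h : IsGFFiltered R M) : ∃ (F C : ModuleCat.{u} R) (ι : M →ₗ[R] F) (π : F →ₗ[R] C),
      IsFlat R F ∧ IsGFFiltered R C ∧ IsShortExact ι π ∧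
      ∀ D : ModuleCat.{u} R, InjExtVanishes R D 1 → ExtVanishes R D F 1 := by
  induction h with
  | base h =>
    obtain ⟨F, C, ι, π, hF, hC, hs⟩ := h.exists_flat_embedding
    have hinj := isFlat_iff_injective.1 hF
    have hdd : IsFlat R (LDual R (RDual R F)) := hR.isFlat_dual hinj
    obtain ⟨α, β, hαβ⟩ := exists_isShortExact_quotient_comp hs (LDual.eval R F)
      LDual.eval_injective
    refine ⟨ModuleCat.of R (LDual R (RDual R F)), ModuleCat.of R _, _, _, hdd, ?_,
      isShortExact_mkQ (LDual.eval R F ∘ₗ ι) (LDual.eval_injective.comp hs.injective),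
      fun D hD => hD _ hinj⟩
    exact .ext (A := C) (C := ModuleCat.of R _) hαβ (.base hC)
      (.base hdd.quotient_eval.isGorensteinFlat)
  | ext h hA hC ihA ihC =>
    obtain ⟨F, D, ι, π, hF, hD, hs, hE⟩ := ihA
    obtain ⟨F', D', ι', π', hF', hD', hs', hE'⟩ := ihC
    obtain ⟨θ, hθ⟩ := (hE _ (hC.injExtVanishes 0)).exists_extension h ι
    obtain ⟨hinj, α, β, hαβ⟩ := exists_isShortExact_quotient_prod h hs hs' θ hθ
    refine ⟨ModuleCat.of R (F × F'), ModuleCat.of R _, _, _, ?_, ?_, isShortExact_mkQ _ hinj,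
      fun D hD => (hE D hD).prod (hE' D hD)⟩
    · exact .middle (f := LinearMap.inl R F F') (g := LinearMap.snd R F F')
        ⟨LinearMap.inl_injective, .inl_snd, LinearMap.snd_surjective⟩ hF hF'
    · exact .ext (A := D) (C := D') hαβ hD hD'

variable (R) in
/-- The modules that become iterated extensions of Gorenstein flat modules after finitely many
steps along short exact sequences with flat middle term. -/
inductive IsEventuallyGFFiltered : ModuleCat.{u} R → Prop
  | base {M : ModuleCat.{u} R} (h : IsGFFiltered R M) : IsEventuallyGFFiltered M
  | step {M N : ModuleCat.{u} R} (h : FlatStep M N) (hM : ∀ n, InjExtVanishes R M (n + 1))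
      (hN : IsEventuallyGFFiltered N) : IsEventuallyGFFiltered M

theorem IsEventuallyGFFiltered.injExtVanishes {M : ModuleCat.{u} R}
    (h : IsEventuallyGFFiltered R M) (n : ℕ) : InjExtVanishes R M (n + 1) := by
  cases h with
  | base h => exact h.injExtVanishes n
  | step _ hM _ => exact hM n

theorem IsGFFiltered.isGorensteinFlat (hR : IsRightCoherent R) {M : ModuleCat.{u} R}
    (h : IsGFFiltered R M) : IsGorensteinFlat R M := by
  obtain ⟨Z, rfl, hZ, hs⟩ := exists_int_chain (IsEventuallyGFFiltered R) FlatStep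
    (fun M hM => by
      cases hM with
      | base h =>
        obtain ⟨F, C, ι, π, hF, hC, hx, -⟩ := h.exists_flat_embedding hR
        exact ⟨C, .base hC, F, ι, π, hF, hx⟩
      | step h _ hN => exact ⟨_, hN, h⟩)
    (fun M hM => by
      obtain ⟨P, π, hP, hπ⟩ := exists_projective_cover R M
      have hx := isShortExact_ker π hπ
      have hst : FlatStep (ModuleCat.of R (LinearMap.ker π)) M :=
        ⟨P, _, π, .of_projective, hx⟩
      -- Vanishing for the kernel in degree n + 1 comes from degree n + 2 for `M`, so vanishing in
      -- all positive degrees must be carried along.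
      exact ⟨_, .step hst (fun n I _ _ hI =>
        .left hx (.of_projective n) (hM.injExtVanishes (n + 1) I hI)) hM, hst⟩)
    M (.base h)
  exact .of_chain Z hs (fun i => (hZ i).injExtVanishes 0) (.refl R _)

theorem IsRightCoherent.isLeftGFClosed (hR : IsRightCoherent R) : IsLeftGFClosed R := by
  intro A B C _ _ _ _ _ _ f g hf hfg hg hA hC
  exact IsGFFiltered.isGorensteinFlat hR (M := ModuleCat.of R B)
    (.ext (A := ModuleCat.of R A) (C := ModuleCat.of R C) (f := f) (g := g) ⟨hf, hfg, hg⟩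
      (.base hA) (.base hC))

theorem isLeftGFClosed_of_weakDim_lt_top (hR : weakDim R < ⊤) : IsLeftGFClosed R := by
  intro A B C _ _ _ _ _ _ f g hf hfg hg hA hC
  exact (IsFlat.middle ⟨hf, hfg, hg⟩ (hA.isFlat_of_weakDim hR)
    (hC.isFlat_of_weakDim hR)).isGorensteinFlat

end Extensions

end GFClosed

theorem proposition2p2 (R : Type u) [Ring R] :
    (GFClosed.IsRightCoherent R → GFClosed.IsLeftGFClosed R) ∧
    (GFClosed.weakDim R < ⊤ → GFClosed.IsLeftGFClosed R) ∧
    (GFClosed.weakDim R < ⊤ → ∀ (M : Type u) [AddCommGroup M] [Module R M],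
      GFClosed.IsGorensteinFlat R M ↔ GFClosed.IsFlat R M) :=
  ⟨GFClosed.IsRightCoherent.isLeftGFClosed, GFClosed.isLeftGFClosed_of_weakDim_lt_top,
    fun h _ _ _ => ⟨fun hM => hM.isFlat_of_weakDim h, GFClosed.IsFlat.isGorensteinFlat⟩⟩
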